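/- Let $|\psi(\theta)\rangle_{AB}=\cos\theta\,|00\rangle+\sin\theta\,|11\rangle$ be a two-qubit link shared by Alice (holding $A$) and Bob (holding $B$), and let a third party, the Bank, distribute the three-qubit state $|W\rangle_{A'B'K}=\alpha|001\rangle+\beta|010\rangle+\gamma|100\rangle$, giving $A'$ to Alice and $B'$ to Bob and keeping $K$. Let $|\Phi^+\rangle=(|00\rangle+|11\rangle)/\sqrt2$, and let LOCC mean bipartite protocols between Alice and Bob with finitely many rounds and finitely many outcomes per round (arbitrary finite-dimensional local operations, ancillas and discarding allowed). Consider two models. - *Transfer model*: the Bank hands $K$ to Alice and leaves. Deterministic restoration is possible if some LOCC protocol, with Alice holding $AA'K$ and Bob holding $BB'$, maps $|\psi(\theta)\rangle_{AB}\otimes|W\rangle_{A'B'K}$ with certainty to $|\Phi^+\rangle$ on $AB$ (all other registers being discarded). - *Bank-measures model*: the Bank performs a measurement on $K$, given by finitely many operators $M_m$ with $\sum_m M_m^\dagger M_m=I$, and broadcasts the outcome $m$. Deterministic restoration is possible if the measurement can be chosen so that for every outcome $m$ of non-zero probability some LOCC protocol (which may depend on $m$), with Alice holding $AA'$ and Bob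 holding $BB'$, maps the conditional state of $AA'BB'$ with certainty to $|\Phi^+\rangle$ on $AB$ (all other registers being discarded). Then there exist real parameters $(\theta,\alpha,\beta,\gamma)$ with $0<\theta\le\pi/4$, $\alpha,\beta,\gamma>0$ and $\alpha^2+\beta^2+\gamma^2=1$ for which deterministic restoration of the Bell pair is possible in the transfer model but impossible in the Bank-measures model. -/

import Mathlib

open scoped Kronecker Matrix

noncomputable section

namespace BankAssist

/-- The standard basis vector `|i⟩`. -/
def ket {n : Type} [DecidableEq n] (i : n) : n → ℂ := Pi.single i 1

/-- The rank-one operator `|v⟩⟨v|`. -/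
def proj {n : Type} (v : n → ℂ) : Matrix n n ℂ := Matrix.vecMulVec v (star v)

/-- Partial trace over the second tensor factor. -/
def partialTrace {m n : Type} [Fintype n] (ρ : Matrix (m × n) (m × n) ℂ) : Matrix m m ℂ :=
  Matrix.of fun i j => ∑ k, ρ (i, k) (j, k)

/-- A finite family of measurement (Kraus) operators from the Hilbert space `ℂ^m` to `ℂ^n`:
`∑ i, (M i)† (M i) = 1`. -/
def IsMeasurement {ι m n : Type} [Fintype ι] [DecidableEq m] [Fintype n]
    (M : ι → Matrix n m ℂ) : Prop :=
  ∑ i, (M i)ᴴ * M i = 1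

/-- Bipartite LOCC maps with finitely many rounds and finitely many outcomes in each round.
Alice holds `ℂ^a` and Bob `ℂ^b`, at the end they hold `ℂ^a'` and `ℂ^b'`; a map acts on operators on
`ℂ^a ⊗ ℂ^b`. A protocol either ends, or one party performs a local measurement (whose output space
may be any finite-dimensional space, which covers local unitaries, adding ancillas and discarding
registers), announces the outcome `i`, and both go on with an LOCC protocol that may depend on `i`.
-/
inductive IsLOCC {a' b' : Type} [Fintype a'] [DecidableEq a'] [Fintype b'] [DecidableEq b'] :
    ∀ {a b : Type} [Fintype a] [DecidableEq a] [Fintype b] [DecidableEq b],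
      (Matrix (a × b) (a × b) ℂ → Matrix (a' × b') (a' × b') ℂ) → Prop
  | finish : IsLOCC (fun ρ : Matrix (a' × b') (a' × b') ℂ => ρ)
  | alice {a b c ι : Type} [Fintype a] [DecidableEq a] [Fintype b] [DecidableEq b]
      [Fintype c] [DecidableEq c] [Fintype ι]
      (M : ι → Matrix c a ℂ) (hM : IsMeasurement M)
      (Φ : ι → Matrix (c × b) (c × b) ℂ → Matrix (a' × b') (a' × b') ℂ)
      (hΦ : ∀ i, IsLOCC (Φ i)) :
      IsLOCC (fun ρ : Matrix (a × b) (a × b) ℂ =>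
        ∑ i, Φ i ((M i ⊗ₖ (1 : Matrix b b ℂ)) * ρ * (M i ⊗ₖ (1 : Matrix b b ℂ))ᴴ))
  | bob {a b c ι : Type} [Fintype a] [DecidableEq a] [Fintype b] [DecidableEq b]
      [Fintype c] [DecidableEq c] [Fintype ι]
      (M : ι → Matrix c b ℂ) (hM : IsMeasurement M)
      (Φ : ι → Matrix (a × c) (a × c) ℂ → Matrix (a' × b') (a' × b') ℂ)
      (hΦ : ∀ i, IsLOCC (Φ i)) :
      IsLOCC (fun ρ : Matrix (a × b) (a × b) ℂ =>
        ∑ i, Φ i (((1 : Matrix a a ℂ) ⊗ₖ M i) * ρ * ((1 : Matrix a a ℂ) ⊗ₖ M i)ᴴ))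

/-- The Bell state `|Φ⁺⟩ = (|00⟩ + |11⟩) / √2` of two qubits. -/
def bellState : Fin 2 × Fin 2 → ℂ :=
  ((1 / Real.sqrt 2 : ℝ) : ℂ) • (ket (0, 0) + ket (1, 1))

/-- Alice and Bob, sharing the state `ρ`, can produce with certainty a perfect Bell pair on the
qubits `A` and `B` by LOCC, all other registers being discarded. -/
def CanRestoreBell {a b : Type} [Fintype a] [DecidableEq a] [Fintype b] [DecidableEq b]
    (ρ : Matrix (a × b) (a × b) ℂ) : Prop :=
  ∃ Φ : Matrix (a × b) (a × b) ℂ → Matrix (Fin 2 × Fin 2) (Fin 2 × Fin 2) ℂ,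
    IsLOCC Φ ∧ Φ ρ = proj bellState

/-- The imperfect link `|ψ(θ)⟩ = cos θ |00⟩ + sin θ |11⟩` on `A B`. -/
def linkState (θ : ℝ) : Fin 2 × Fin 2 → ℂ :=
  (Real.cos θ : ℂ) • ket (0, 0) + (Real.sin θ : ℂ) • ket (1, 1)

/-- The W-class resource `α |001⟩ + β |010⟩ + γ |100⟩` on `A' B' K`. -/
def wState (α β γ : ℝ) : Fin 2 × Fin 2 × Fin 2 → ℂ :=
  (α : ℂ) • ket (0, 0, 1) + (β : ℂ) • ket (0, 1, 0) + (γ : ℂ) • ket (1, 0, 0)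

/-- The state `|ψ⟩_{AB} ⊗ |Ω⟩_{A'B'K}` with registers grouped as `(A A' K) | (B B')`: the Bank has
handed `K` to Alice. -/
def transferredState (ψ : Fin 2 × Fin 2 → ℂ) (Ω : Fin 2 × Fin 2 × Fin 2 → ℂ) :
    (Fin 2 × Fin 2 × Fin 2) × (Fin 2 × Fin 2) → ℂ :=
  fun x => match x with
    | ((a, a', k), (b, b')) => ψ (a, b) * Ω (a', b', k)

/-- The state `|ψ⟩_{AB} ⊗ |Ω⟩_{A'B'K}` with registers grouped as `((A A') | (B B')) | K`: the Bank
holds `K`. -/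
def distributedState (ψ : Fin 2 × Fin 2 → ℂ) (Ω : Fin 2 × Fin 2 × Fin 2 → ℂ) :
    ((Fin 2 × Fin 2) × (Fin 2 × Fin 2)) × Fin 2 → ℂ :=
  fun x => match x with
    | (((a, a'), (b, b')), k) => ψ (a, b) * Ω (a', b', k)

/-- Deterministic Bell-pair restoration is possible in the transfer model. -/
def TransferFeasible (ψ : Fin 2 × Fin 2 → ℂ) (Ω : Fin 2 × Fin 2 × Fin 2 → ℂ) : Prop :=
  CanRestoreBell (proj (transferredState ψ Ω))

/-- The unnormalized state of the registers `A A' | B B'` after the Bank has applied the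
measurement operator `M` to `K`. -/
def branch (ψ : Fin 2 × Fin 2 → ℂ) (Ω : Fin 2 × Fin 2 × Fin 2 → ℂ)
    (M : Matrix (Fin 2) (Fin 2) ℂ) :
    Matrix ((Fin 2 × Fin 2) × (Fin 2 × Fin 2)) ((Fin 2 × Fin 2) × (Fin 2 × Fin 2)) ℂ :=
  partialTrace (proj (((1 : Matrix ((Fin 2 × Fin 2) × (Fin 2 × Fin 2))
    ((Fin 2 × Fin 2) × (Fin 2 × Fin 2)) ℂ) ⊗ₖ M) *ᵥ distributedState ψ Ω))

/-- Deterministic Bell-pair restoration is possible in the Bank-measures model: for some finite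
measurement of `K`, every outcome `i` of non-zero probability leaves Alice and Bob, who learn `i`,
with a (normalized) state from which they can restore the Bell pair by LOCC. -/
def BankMeasuresFeasible (ψ : Fin 2 × Fin 2 → ℂ) (Ω : Fin 2 × Fin 2 × Fin 2 → ℂ) : Prop :=
  ∃ (n : ℕ) (M : Fin n → Matrix (Fin 2) (Fin 2) ℂ), IsMeasurement M ∧
    ∀ i, (branch ψ Ω (M i)).trace ≠ 0 →
      CanRestoreBell ((branch ψ Ω (M i)).trace⁻¹ • branch ψ Ω (M i))

end BankAssist

end

open scoped Kronecker Matrix ComplexOrder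

namespace BankAssist

/-! The two models are limited by different marginals of the W state. With `K` at Alice's side,
Bob's reduced state is diagonal with top eigenvalue `cos² θ (α² + γ²)`, and when this equals `1/2`
an explicit protocol succeeds (`canRestoreBell_of_conjTranspose_mul_self`): Bob merges his other
three levels into one, then Alice undoes an isometry.

If the Bank measures, each row of each Kraus operator gives a pure component of the conditional
state. Since the target is pure, each component must itself be convertible to a Bell pair, so its
top squared Schmidt coefficient is at most half its weight (`IsLOCC.sqNorm_coeffMatrix_mulVec_le`).
Testing this on Alice's `|00⟩` and summing over rows and outcomes removes the measurement and leaves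
`cos² θ (α² + β²) ≤ 1/2`. Any case of equality in the first condition with `γ < β` separates the
models. -/

/-- The squared norm of a complex vector. -/
def sqNorm {n : Type} [Fintype n] (v : n → ℂ) : ℝ := ∑ i, Complex.normSq (v i)

/-- The coefficient matrix of a bipartite vector. -/
def coeffMatrix {a b : Type} (φ : a × b → ℂ) : Matrix a b ℂ := Matrix.of fun i j => φ (i, j)

/-! ### Norms, coefficient matrices and pure-state extremality -/

section Vectors

variable {a b c m n ι : Type} [Fintype n] [Fintype ι]

lemma sqNorm_nonneg (v : n → ℂ) : 0 ≤ sqNorm v :=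
  Finset.sum_nonneg fun _ _ => Complex.normSq_nonneg _

lemma star_dotProduct_self (v : n → ℂ) : star v ⬝ᵥ v = (sqNorm v : ℂ) := by
  simp [sqNorm, dotProduct, Complex.normSq_eq_conj_mul_self]

lemma sqNorm_star (v : n → ℂ) : sqNorm (star v) = sqNorm v := by
  simp [sqNorm, Complex.normSq_conj]

lemma sqNorm_ket [DecidableEq n] (i : n) : sqNorm (ket i) = 1 := by
  rw [sqNorm, Finset.sum_eq_single i (fun j _ hj => by simp [ket, hj]) (by simp)]
  simp [ket]

lemma sqNorm_eq_zero {v : n → ℂ} (h : sqNorm v = 0) : v = 0 := by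
  funext i
  have := (Finset.sum_eq_zero_iff_of_nonneg (fun i _ => Complex.normSq_nonneg (v i))).1 h i
    (Finset.mem_univ i)
  simpa using this

lemma normSq_dotProduct_le (u v : n → ℂ) :
    Complex.normSq (u ⬝ᵥ v) ≤ sqNorm u * sqNorm v := by
  have h1 : ‖u ⬝ᵥ v‖ ≤ ∑ i, ‖u i‖ * ‖v i‖ := by
    refine (norm_sum_le _ _).trans (le_of_eq ?_)
    simp
  have h2 := Finset.sum_mul_sq_le_sq_mul_sq Finset.univ (fun i => ‖u i‖) (fun i => ‖v i‖)
  simp only [sqNorm, Complex.normSq_eq_norm_sq]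
  exact (pow_le_pow_left₀ (norm_nonneg _) h1 2).trans h2

/-- A bound on the norm of a matrix is also a bound on the norm of its transpose. -/
lemma sqNorm_transpose_mulVec_le [Fintype a] [Fintype b] (X : Matrix a b ℂ) {s : ℝ} (hs : 0 ≤ s)
    (h : ∀ w, sqNorm (X *ᵥ w) ≤ s * sqNorm w) (u : a → ℂ) :
    sqNorm (Xᵀ *ᵥ u) ≤ s * sqNorm u := by
  -- Cauchy–Schwarz gives `‖z‖⁴ ≤ s ‖z‖² ‖u‖²`; cancel `‖z‖²`.
  set z := Xᵀ *ᵥ u with hz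
  have h1 : star z ⬝ᵥ z = (X *ᵥ star z) ⬝ᵥ u := by
    rw [hz, Matrix.dotProduct_mulVec, Matrix.vecMul_transpose]
  rw [star_dotProduct_self] at h1
  have h2 := normSq_dotProduct_le (X *ᵥ star z) u
  rw [← h1, Complex.normSq_ofReal] at h2
  have h3 := h (star z)
  rw [sqNorm_star] at h3
  have h4 := mul_le_mul_of_nonneg_right h3 (sqNorm_nonneg u)
  rcases (sqNorm_nonneg z).eq_or_lt with h0 | h0
  · rw [← h0]; exact mul_nonneg hs (sqNorm_nonneg u)
  · refine le_of_mul_le_mul_right ?_ h0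
    linarith

lemma mul_proj_mul_conjTranspose (A : Matrix m n ℂ) (v : n → ℂ) :
    A * proj v * Aᴴ = proj (A *ᵥ v) := by
  rw [proj, proj, Matrix.mul_vecMulVec, Matrix.vecMulVec_mul, Matrix.star_mulVec]

lemma posSemidef_proj (v : n → ℂ) : (proj v).PosSemidef :=
  Matrix.posSemidef_vecMulVec_self_star v

lemma trace_proj (v : n → ℂ) : (proj v).trace = (sqNorm v : ℂ) := by
  rw [proj, Matrix.trace_vecMulVec, dotProduct_comm, star_dotProduct_self]

lemma coeffMatrix_kronecker_one_mulVec [Fintype a] [Fintype b] [DecidableEq b]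
    (M : Matrix c a ℂ) (φ : a × b → ℂ) :
    coeffMatrix ((M ⊗ₖ (1 : Matrix b b ℂ)) *ᵥ φ) = M * coeffMatrix φ := by
  ext i j
  simp [coeffMatrix, Matrix.mulVec, dotProduct, Fintype.sum_prod_type, Matrix.mul_apply,
    Matrix.one_apply]

lemma coeffMatrix_one_kronecker_mulVec [Fintype a] [Fintype b] [DecidableEq a]
    (M : Matrix c b ℂ) (φ : a × b → ℂ) :
    coeffMatrix (((1 : Matrix a a ℂ) ⊗ₖ M) *ᵥ φ) = coeffMatrix φ * Mᵀ := by
  ext i j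
  simp [coeffMatrix, Matrix.mulVec, dotProduct, Fintype.sum_prod_type, Matrix.mul_apply,
    Matrix.one_apply, mul_comm, Finset.sum_ite_eq]

lemma IsMeasurement.sum_sqNorm [Fintype m] [DecidableEq m] {M : ι → Matrix n m ℂ}
    (hM : IsMeasurement M) (v : m → ℂ) : ∑ i, sqNorm (M i *ᵥ v) = sqNorm v := by
  have h : star v ⬝ᵥ ((∑ i, (M i)ᴴ * M i) *ᵥ v) = (sqNorm v : ℂ) := by
    rw [show ∑ i, (M i)ᴴ * M i = 1 from hM, Matrix.one_mulVec, star_dotProduct_self]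
  rw [Matrix.sum_mulVec, dotProduct_sum] at h
  have h' : ∀ i, star v ⬝ᵥ (((M i)ᴴ * M i) *ᵥ v) = (sqNorm (M i *ᵥ v) : ℂ) := fun i => by
    rw [← star_dotProduct_self, Matrix.star_mulVec, ← Matrix.mulVec_mulVec,
      Matrix.dotProduct_mulVec]
  simp only [h'] at h
  exact_mod_cast h

lemma IsMeasurement.kronecker_one [DecidableEq a] [Fintype b] [DecidableEq b] [Fintype c]
    {M : ι → Matrix c a ℂ} (hM : IsMeasurement M) :
    IsMeasurement fun i => M i ⊗ₖ (1 : Matrix b b ℂ) := by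
  unfold IsMeasurement at *
  simp only [Matrix.conjTranspose_kronecker, ← Matrix.mul_kronecker_mul,
    Matrix.conjTranspose_one, mul_one]
  rw [← Matrix.one_kronecker_one, ← hM]
  ext ⟨i, j⟩ ⟨k, l⟩
  simp [Matrix.sum_apply, Finset.sum_mul]

lemma IsMeasurement.one_kronecker [Fintype a] [DecidableEq a] [DecidableEq b] [Fintype c]
    {M : ι → Matrix c b ℂ} (hM : IsMeasurement M) :
    IsMeasurement fun i => (1 : Matrix a a ℂ) ⊗ₖ M i := by
  unfold IsMeasurement at *
  simp only [Matrix.conjTranspose_kronecker, ← Matrix.mul_kronecker_mul,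
    Matrix.conjTranspose_one, mul_one]
  rw [← Matrix.one_kronecker_one, ← hM]
  ext ⟨i, j⟩ ⟨k, l⟩
  simp [Matrix.sum_apply, Finset.mul_sum]

/-- Positive semidefinite matrices that sum up to a multiple of a pure state are multiples of that
state. -/
lemma exists_eq_smul_proj_of_sum_eq [DecidableEq n] {v : n → ℂ} (hv : sqNorm v = 1)
    {A : ι → Matrix n n ℂ} (hA : ∀ i, (A i).PosSemidef) {t : ℂ} (h : ∑ i, A i = t • proj v)
    (i : ι) : A i = (A i).trace • proj v := by
  have hvv : star v ⬝ᵥ v = 1 := by rw [star_dotProduct_self, hv]; simp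
  -- On `x ⊥ v` the nonnegative expectations sum to zero, so each vanishes, and positivity puts `x`
  -- in each kernel.
  have hker : ∀ x, star v ⬝ᵥ x = 0 → A i *ᵥ x = 0 := by
    intro x hx
    rw [← (hA i).dotProduct_mulVec_zero_iff]
    have hsum : ∑ j, star x ⬝ᵥ (A j *ᵥ x) = 0 := by
      rw [← dotProduct_sum, ← Matrix.sum_mulVec, h, proj, Matrix.smul_mulVec,
        Matrix.vecMulVec_mulVec, hx]
      simp
    exact (Finset.sum_eq_zero_iff_of_nonneg
      fun j _ => (hA j).dotProduct_mulVec_nonneg x).1 hsum i (Finset.mem_univ i)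
  have hright : A i = A i * proj v := by
    refine Matrix.ext_of_mulVec_single fun k => ?_
    have h0 := hker (Pi.single k 1 - proj v *ᵥ Pi.single k 1) (by
      rw [dotProduct_sub, proj, Matrix.vecMulVec_mulVec]
      simp [hvv, dotProduct_smul])
    rw [Matrix.mulVec_sub, sub_eq_zero, Matrix.mulVec_mulVec] at h0
    exact h0
  have hproj : (proj v)ᴴ = proj v := (posSemidef_proj v).1
  have hleft : A i = proj v * A i := by
    have := congrArg Matrix.conjTranspose hright
    rwa [Matrix.conjTranspose_mul, (hA i).1, hproj] at this
  obtain ⟨s, hs⟩ : ∃ s : ℂ, A i = s • proj v := by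
    refine ⟨star v ⬝ᵥ (A i *ᵥ v), ?_⟩
    conv_lhs => rw [hleft, hright]
    rw [proj, Matrix.mul_vecMulVec, Matrix.vecMulVec_mul_vecMulVec]
    ext k l
    simp [Matrix.vecMulVec_apply, mul_comm, mul_assoc]
  have htr : (A i).trace = s := by
    rw [hs, Matrix.trace_smul, trace_proj, hv]
    simp
  rw [htr, hs]

end Vectors

/-! ### Linearity and positivity of LOCC maps -/

section LOCC

variable {a b a' b' : Type} [Fintype a] [DecidableEq a] [Fintype b] [DecidableEq b]
  [Fintype a'] [DecidableEq a'] [Fintype b'] [DecidableEq b']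
  {Φ : Matrix (a × b) (a × b) ℂ → Matrix (a' × b') (a' × b') ℂ}

lemma IsLOCC.map_add (h : IsLOCC Φ) (ρ σ : Matrix (a × b) (a × b) ℂ) :
    Φ (ρ + σ) = Φ ρ + Φ σ := by
  induction h with
  | finish => rfl
  | alice M hM Φ hΦ ih =>
    simp only [Matrix.mul_add, Matrix.add_mul, ih, Finset.sum_add_distrib]
  | bob M hM Φ hΦ ih =>
    simp only [Matrix.mul_add, Matrix.add_mul, ih, Finset.sum_add_distrib]

lemma IsLOCC.map_smul (h : IsLOCC Φ) (s : ℂ) (ρ : Matrix (a × b) (a × b) ℂ) :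
    Φ (s • ρ) = s • Φ ρ := by
  induction h with
  | finish => rfl
  | alice M hM Φ hΦ ih => simp [ih, Finset.smul_sum]
  | bob M hM Φ hΦ ih => simp [ih, Finset.smul_sum]

lemma IsLOCC.map_sum (h : IsLOCC Φ) {ι : Type} [Fintype ι]
    (ρ : ι → Matrix (a × b) (a × b) ℂ) : Φ (∑ i, ρ i) = ∑ i, Φ (ρ i) :=
  _root_.map_sum (⟨⟨Φ, h.map_add⟩, h.map_smul⟩ : _ →ₗ[ℂ] _) ρ Finset.univ

lemma IsLOCC.posSemidef (h : IsLOCC Φ) {ρ : Matrix (a × b) (a × b) ℂ} (hρ : ρ.PosSemidef) :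
    (Φ ρ).PosSemidef := by
  induction h with
  | finish => exact hρ
  | alice M hM Φ hΦ ih =>
    exact Matrix.posSemidef_sum _ fun i _ => ih i (hρ.mul_mul_conjTranspose_same _)
  | bob M hM Φ hΦ ih =>
    exact Matrix.posSemidef_sum _ fun i _ => ih i (hρ.mul_mul_conjTranspose_same _)

end LOCC

lemma bellState_apply (i j : Fin 2) :
    bellState (i, j) = if i = j then ((1 / Real.sqrt 2 : ℝ) : ℂ) else 0 := by
  fin_cases i <;> fin_cases j <;> simp [bellState, ket]

lemma sqNorm_bellState : sqNorm bellState = 1 := by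
  simp [sqNorm, Fintype.sum_prod_type, bellState_apply]
  norm_num

/-! ### The Schmidt coefficient bound -/

section Bound

variable {a b : Type} [Fintype a] [DecidableEq a] [Fintype b] [DecidableEq b]

/-- The diagonal of the hypothesis suffices: the coefficient matrix is diagonal with entries of
equal modulus, so equality holds. -/
lemma sqNorm_coeffMatrix_mulVec_le_of_proj_eq {φ : Fin 2 × Fin 2 → ℂ} {t : ℂ}
    (h : proj φ = t • proj bellState) (w : Fin 2 → ℂ) :
    sqNorm (coeffMatrix φ *ᵥ w) ≤ sqNorm φ / 2 * sqNorm w := by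
  have hd : ∀ i j, (Complex.normSq (φ (i, j)) : ℂ) = if i = j then t / 2 else 0 := by
    intro i j
    have hij := congrFun (congrFun h (i, j)) (i, j)
    simp only [proj, Matrix.smul_apply, Matrix.vecMulVec_apply, Pi.star_apply, RCLike.star_def,
      Complex.mul_conj, bellState_apply, smul_eq_mul] at hij
    rw [hij]
    split_ifs
    · rw [Complex.normSq_ofReal]
      have : (1 / Real.sqrt 2) * (1 / Real.sqrt 2) = 1 / 2 := by
        rw [div_mul_div_comm, Real.mul_self_sqrt (by norm_num)]; norm_num
      rw [this]
      push_cast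
      ring
    · simp
  have h00 := hd 0 0
  have h11 := hd 1 1
  have h01 := hd 0 1
  have h10 := hd 1 0
  simp only [Fin.isValue, if_true, zero_ne_one, one_ne_zero, if_false, Complex.ofReal_eq_zero,
    map_eq_zero] at h00 h11 h01 h10
  have heq : Complex.normSq (φ (1, 1)) = Complex.normSq (φ (0, 0)) := by
    exact_mod_cast h11.trans h00.symm
  refine le_of_eq ?_
  simp [sqNorm, Fintype.sum_prod_type, Matrix.mulVec, dotProduct, coeffMatrix, h01, h10, heq]
  ring

/-- If a bipartite pure state can be converted to a Bell pair with certainty, then its largest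
squared Schmidt coefficient is at most one half. -/
theorem IsLOCC.sqNorm_coeffMatrix_mulVec_le
    {Φ : Matrix (a × b) (a × b) ℂ → Matrix (Fin 2 × Fin 2) (Fin 2 × Fin 2) ℂ} (h : IsLOCC Φ)
    {φ : a × b → ℂ} {t : ℂ} (ht : Φ (proj φ) = t • proj bellState) (w : b → ℂ) :
    sqNorm (coeffMatrix φ *ᵥ w) ≤ sqNorm φ / 2 * sqNorm w := by
  induction h generalizing t with
  | finish => exact sqNorm_coeffMatrix_mulVec_le_of_proj_eq ht w
  | alice M hM Φ hΦ ih =>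
    simp only [mul_proj_mul_conjTranspose] at ht
    have hi := fun i => ih i (exists_eq_smul_proj_of_sum_eq sqNorm_bellState
      (fun i => (hΦ i).posSemidef (posSemidef_proj _)) ht i) w
    simp only [coeffMatrix_kronecker_one_mulVec, ← Matrix.mulVec_mulVec] at hi
    have hsum := Finset.sum_le_sum fun i (_ : i ∈ Finset.univ) => hi i
    rw [hM.sum_sqNorm, ← Finset.sum_mul, ← Finset.sum_div, hM.kronecker_one.sum_sqNorm] at hsum
    exact hsum
  | bob M hM Φ hΦ ih =>
    simp only [mul_proj_mul_conjTranspose] at ht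
    -- Bob's operators act on the right of the coefficient matrix; transposing makes them act on the
    -- left, where completeness can be summed.
    have hi := fun i u => sqNorm_transpose_mulVec_le _
      (div_nonneg (sqNorm_nonneg _) zero_le_two)
      (ih i (exists_eq_smul_proj_of_sum_eq sqNorm_bellState
        (fun i => (hΦ i).posSemidef (posSemidef_proj _)) ht i)) u
    simp only [coeffMatrix_one_kronecker_mulVec, Matrix.transpose_mul, Matrix.transpose_transpose,
      ← Matrix.mulVec_mulVec] at hi
    refine sqNorm_transpose_mulVec_le (coeffMatrix _)ᵀ
      (div_nonneg (sqNorm_nonneg _) zero_le_two) (fun u => ?_) w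
    have hsum := Finset.sum_le_sum fun i (_ : i ∈ Finset.univ) => hi i u
    rw [hM.sum_sqNorm, ← Finset.sum_mul, ← Finset.sum_div, hM.one_kronecker.sum_sqNorm] at hsum
    exact hsum

/-- The reduced state of Alice in each pure component of a state that can be converted to a Bell
pair has its eigenvalues bounded by one half. -/
theorem CanRestoreBell.sqNorm_transpose_coeffMatrix_mulVec_le {ι : Type} [Fintype ι]
    {φ : ι → a × b → ℂ} {s : ℂ} (hs : s ≠ 0) (h : CanRestoreBell (s⁻¹ • ∑ r, proj (φ r))) (r : ι)
    (u : a → ℂ) :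
    sqNorm ((coeffMatrix (φ r))ᵀ *ᵥ u) ≤ sqNorm (φ r) / 2 * sqNorm u := by
  obtain ⟨Φ, hΦ, hρ⟩ := h
  rw [hΦ.map_smul, inv_smul_eq_iff₀ hs, hΦ.map_sum] at hρ
  exact sqNorm_transpose_mulVec_le _ (div_nonneg (sqNorm_nonneg _) zero_le_two)
    (hΦ.sqNorm_coeffMatrix_mulVec_le (exists_eq_smul_proj_of_sum_eq sqNorm_bellState
      (fun i => hΦ.posSemidef (posSemidef_proj _)) hρ r)) u

end Bound

/-! ### Explicit restoration protocols -/

section Protocols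

variable {a b : Type} [Fintype a] [DecidableEq a] [Fintype b] [DecidableEq b]

/-- Alice's measurement that undoes the isometry `V`. -/
def undoIsometry (V : Matrix a (Fin 2) ℂ) : Option a → Matrix (Fin 2) a ℂ
  | none => Vᴴ
  | some x => Matrix.vecMulVec (ket 0) ((1 - V * Vᴴ : Matrix a a ℂ) x)

/-- `Q = 1 - V Vᴴ` is a projection, and the operators built from its rows contribute `Qᴴ Q = Q`. -/
lemma isMeasurement_undoIsometry {V : Matrix a (Fin 2) ℂ} (hV : Vᴴ * V = 1) :
    IsMeasurement (undoIsometry V) := by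
  have hQ : (1 - V * Vᴴ)ᴴ * (1 - V * Vᴴ) = 1 - V * Vᴴ := by
    have : V * Vᴴ * (V * Vᴴ) = V * Vᴴ := by
      rw [Matrix.mul_assoc, ← Matrix.mul_assoc Vᴴ, hV, Matrix.one_mul]
    simp [Matrix.sub_mul, Matrix.mul_sub, this]
  have hsum : ∑ x, (undoIsometry V (some x))ᴴ * undoIsometry V (some x) = 1 - V * Vᴴ := by
    simp only [undoIsometry]
    revert hQ
    generalize (1 - V * Vᴴ : Matrix a a ℂ) = Q
    intro hQ
    conv_rhs => rw [← hQ]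
    ext y z
    simp [Matrix.sum_apply, Matrix.mul_apply, Matrix.vecMulVec_apply, ket]
  rw [IsMeasurement, Fintype.sum_option, hsum]
  simp [undoIsometry]

lemma proj_smul {n : Type} (s : ℂ) (v : n → ℂ) :
    proj (s • v) = (Complex.normSq s : ℂ) • proj v := by
  ext i j
  simp [proj, Matrix.vecMulVec_apply, ← Complex.mul_conj]
  ring

lemma coeffMatrix_injective {a b : Type} :
    Function.Injective (coeffMatrix : (a × b → ℂ) → Matrix a b ℂ) := fun _ _ h =>
  funext fun x => congrFun (congrFun h x.1) x.2

lemma coeffMatrix_bellState : coeffMatrix bellState = ((1 / Real.sqrt 2 : ℝ) : ℂ) • 1 := by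
  ext i j
  simp [coeffMatrix, bellState_apply, Matrix.one_apply]

/-- A pure state whose coefficient matrix is a multiple of an isometry is locally equivalent to a
Bell pair. -/
lemma exists_isLOCC_of_conjTranspose_mul_self {φ : a × Fin 2 → ℂ} {r : ℝ} (hr : 0 < r)
    (h : (coeffMatrix φ)ᴴ * coeffMatrix φ = (r : ℂ) • 1) :
    ∃ Φ : Matrix (a × Fin 2) (a × Fin 2) ℂ → Matrix (Fin 2 × Fin 2) (Fin 2 × Fin 2) ℂ,
      IsLOCC Φ ∧ Φ (proj φ) = ((2 * r : ℝ) : ℂ) • proj bellState := by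
  set q : ℂ := ((Real.sqrt r : ℝ) : ℂ) with hq
  have hq0 : q ≠ 0 := by simp [hq, (Real.sqrt_pos.2 hr).ne']
  have hqq : q * q = r := by
    rw [hq, ← Complex.ofReal_mul, Real.mul_self_sqrt hr.le]
  have hqs : star q = q := Complex.conj_ofReal _
  set V := q⁻¹ • coeffMatrix φ with hVdef
  have hφ : coeffMatrix φ = q • V := by rw [hVdef, smul_smul, mul_inv_cancel₀ hq0, one_smul]
  have hV : Vᴴ * V = 1 := by
    rw [hVdef, Matrix.conjTranspose_smul, Matrix.smul_mul, Matrix.mul_smul, h, smul_smul, smul_smul,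
      star_inv₀, hqs, ← mul_inv_rev, hqq, inv_mul_cancel₀ (by exact_mod_cast hr.ne'), one_smul]
  refine ⟨_, .alice (undoIsometry V) (isMeasurement_undoIsometry hV) (fun _ ρ => ρ)
    (fun _ => .finish), ?_⟩
  simp only [mul_proj_mul_conjTranspose, Fintype.sum_option]
  have hnone : (undoIsometry V none ⊗ₖ (1 : Matrix (Fin 2) (Fin 2) ℂ)) *ᵥ φ
      = (q * ((Real.sqrt 2 : ℝ) : ℂ)) • bellState := by
    apply coeffMatrix_injective
    rw [coeffMatrix_kronecker_one_mulVec, hφ, undoIsometry, Matrix.mul_smul, hV]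
    change _ = (q * ((Real.sqrt 2 : ℝ) : ℂ)) • coeffMatrix bellState
    rw [coeffMatrix_bellState, smul_smul, mul_assoc, ← Complex.ofReal_mul,
      mul_one_div_cancel (by positivity)]
    simp
  -- These outcomes never occur, because `(1 - V Vᴴ) V = 0`.
  have hsome : ∀ x, (undoIsometry V (some x) ⊗ₖ (1 : Matrix (Fin 2) (Fin 2) ℂ)) *ᵥ φ = 0 := by
    intro x
    apply coeffMatrix_injective
    rw [coeffMatrix_kronecker_one_mulVec, hφ, undoIsometry, Matrix.mul_smul, Matrix.vecMulVec_mul]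
    have hz : (1 - V * Vᴴ : Matrix a a ℂ) x ᵥ* V = 0 := by
      change ((1 - V * Vᴴ : Matrix a a ℂ) * V) x = 0
      rw [Matrix.sub_mul, Matrix.mul_assoc, hV, Matrix.one_mul, Matrix.mul_one, sub_self]
      rfl
    rw [hz]
    ext i j
    simp [coeffMatrix]
  rw [hnone, proj_smul]
  simp only [hsome]
  rw [map_mul, hq, Complex.normSq_ofReal, Complex.normSq_ofReal, Real.mul_self_sqrt hr.le,
    Real.mul_self_sqrt zero_le_two]
  simp [proj, mul_comm]

/-- Bob's measurement that singles out `|00⟩` and merges the other basis vectors with signs. -/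
noncomputable def mergeMeasurement (p : Fin 2 × Fin 2) : Matrix (Fin 2) (Fin 2 × Fin 2) ℂ :=
  Matrix.of fun i y =>
    ![![![1 / 2, 0], ![0, 0]], ![![0, 1 / 2], ![(-1) ^ (p.1 : ℕ) / 2, (-1) ^ (p.2 : ℕ) / 2]]]
      i y.1 y.2

/-- Cross terms among the merged levels carry a sign that averages to zero over the four outcomes.
-/
lemma isMeasurement_mergeMeasurement : IsMeasurement mergeMeasurement := by
  rw [IsMeasurement]
  ext ⟨i, j⟩ ⟨k, l⟩
  fin_cases i <;> fin_cases j <;> fin_cases k <;> fin_cases l <;>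
    simp [mergeMeasurement, Matrix.sum_apply, Matrix.mul_apply, Fintype.sum_prod_type,
      Complex.conj_ofNat] <;> norm_num

/-- A pure state with diagonal reduced state `d` on Bob's side, whose first entry is one half, can
be converted to a Bell pair. -/
lemma canRestoreBell_of_conjTranspose_mul_self {φ : a × (Fin 2 × Fin 2) → ℂ}
    {d : Fin 2 × Fin 2 → ℂ} (h : (coeffMatrix φ)ᴴ * coeffMatrix φ = Matrix.diagonal d)
    (hd : d (0, 0) = 1 / 2) (hd' : d (0, 1) + d (1, 0) + d (1, 1) = 1 / 2) :
    CanRestoreBell (proj φ) := by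
  have key : ∀ p, ∃ Φ : Matrix (a × Fin 2) (a × Fin 2) ℂ →
      Matrix (Fin 2 × Fin 2) (Fin 2 × Fin 2) ℂ, IsLOCC Φ ∧
      Φ (proj (((1 : Matrix a a ℂ) ⊗ₖ mergeMeasurement p) *ᵥ φ))
        = ((2 * (1 / 8) : ℝ) : ℂ) • proj bellState := by
    intro p
    -- Each outcome has probability `1/4` and leaves Bob with `1/8` times the identity.
    refine exists_isLOCC_of_conjTranspose_mul_self (by norm_num) ?_
    rw [coeffMatrix_one_kronecker_mulVec, Matrix.conjTranspose_mul, Matrix.mul_assoc,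
      ← Matrix.mul_assoc _ (coeffMatrix φ), h]
    have hd'' : d (1, 1) = 1 / 2 - d (0, 1) - d (1, 0) := by rw [← hd']; ring
    obtain ⟨p, q⟩ := p
    ext i j
    fin_cases i <;> fin_cases j <;> fin_cases p <;> fin_cases q <;>
      simp [mergeMeasurement, Matrix.mul_apply, Fintype.sum_prod_type, Matrix.diagonal_apply, hd,
        hd'', Complex.conj_ofNat] <;> ring
  choose Φ hΦ hρ using key
  refine ⟨_, .bob mergeMeasurement isMeasurement_mergeMeasurement Φ hΦ, ?_⟩
  simp only [mul_proj_mul_conjTranspose, hρ, Finset.sum_const, Finset.card_univ]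
  ext i j
  simp
  ring

end Protocols

/-! ### The two models for the W-class resource -/

lemma wState_apply (α β γ : ℝ) (i j k : Fin 2) :
    wState α β γ (i, j, k) =
      ![![![0, (α : ℂ)], ![(β : ℂ), 0]], ![![(γ : ℂ), 0], ![0, 0]]] i j k := by
  fin_cases i <;> fin_cases j <;> fin_cases k <;> simp [wState, ket]

lemma linkState_apply (θ : ℝ) (i j : Fin 2) :
    linkState θ (i, j) = ![![(Real.cos θ : ℂ), 0], ![0, (Real.sin θ : ℂ)]] i j := by
  fin_cases i <;> fin_cases j <;> simp [linkState, ket]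

/-- If the largest squared Schmidt coefficient `cos² θ (α² + γ²)` is one half, restoration is
possible in the transfer model. -/
theorem transferFeasible {θ α β γ : ℝ} (hn : α ^ 2 + β ^ 2 + γ ^ 2 = 1)
    (h : Real.cos θ ^ 2 * (α ^ 2 + γ ^ 2) = 1 / 2) :
    TransferFeasible (linkState θ) (wState α β γ) := by
  refine canRestoreBell_of_conjTranspose_mul_self
    (d := fun y => ![(Real.cos θ : ℂ) ^ 2, (Real.sin θ : ℂ) ^ 2] y.1 *
      ![(α : ℂ) ^ 2 + (γ : ℂ) ^ 2, (β : ℂ) ^ 2] y.2) ?_ ?_ ?_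
  · ext ⟨i, j⟩ ⟨k, l⟩
    fin_cases i <;> fin_cases j <;> fin_cases k <;> fin_cases l <;>
      simp [coeffMatrix, transferredState, Matrix.mul_apply, Fintype.sum_prod_type, wState_apply,
        linkState_apply, -Complex.ofReal_cos, -Complex.ofReal_sin] <;> ring
  · simp only [Matrix.cons_val_zero]
    have hc := congrArg Complex.ofReal h
    push_cast at hc ⊢
    exact hc
  · simp only [Matrix.cons_val_zero, Matrix.cons_val_one]
    have := Real.sin_sq_add_cos_sq θ
    have h' : Real.cos θ ^ 2 * β ^ 2 + Real.sin θ ^ 2 * (α ^ 2 + γ ^ 2) + Real.sin θ ^ 2 * β ^ 2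
        = 1 / 2 := by linear_combination this + hn * (Real.sin θ ^ 2 + Real.cos θ ^ 2) - h
    have hc := congrArg Complex.ofReal h'
    push_cast at hc ⊢
    exact hc

/-- The component of the post-measurement state that belongs to the `r`-th row of the Bank's
measurement operator. -/
def branchComponent (ψ : Fin 2 × Fin 2 → ℂ) (Ω : Fin 2 × Fin 2 × Fin 2 → ℂ)
    (M : Matrix (Fin 2) (Fin 2) ℂ) (r : Fin 2) : (Fin 2 × Fin 2) × (Fin 2 × Fin 2) → ℂ :=
  fun x => ∑ k, M r k * distributedState ψ Ω (x, k)

/-- Tracing out the Bank's output register decomposes the conditional state along the rows of `M`.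
-/
lemma branch_eq_sum (ψ : Fin 2 × Fin 2 → ℂ) (Ω : Fin 2 × Fin 2 × Fin 2 → ℂ)
    (M : Matrix (Fin 2) (Fin 2) ℂ) : branch ψ Ω M = ∑ r, proj (branchComponent ψ Ω M r) := by
  have h : ∀ x r, (((1 : Matrix ((Fin 2 × Fin 2) × (Fin 2 × Fin 2))
      ((Fin 2 × Fin 2) × (Fin 2 × Fin 2)) ℂ) ⊗ₖ M) *ᵥ distributedState ψ Ω) (x, r)
      = branchComponent ψ Ω M r x := fun x r => by
    rw [Matrix.mulVec, dotProduct, Fintype.sum_prod_type, Finset.sum_eq_single x]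
    · simp [branchComponent]
    · intro y _ hy
      simp [Matrix.one_apply_ne hy.symm]
    · simp
  ext x y
  simp [branch, partialTrace, proj, Matrix.vecMulVec_apply, h]

lemma sqNorm_branchComponent (θ α β γ : ℝ) (M : Matrix (Fin 2) (Fin 2) ℂ) (r : Fin 2) :
    sqNorm (branchComponent (linkState θ) (wState α β γ) M r)
      = Complex.normSq (M r 1) * α ^ 2 + Complex.normSq (M r 0) * (β ^ 2 + γ ^ 2) := by
  simp [sqNorm, branchComponent, distributedState, Fintype.sum_prod_type, wState_apply,
    linkState_apply, Complex.normSq_ofReal, -Complex.ofReal_cos, -Complex.ofReal_sin]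
  have := Real.sin_sq_add_cos_sq θ
  linear_combination (Complex.normSq (M r 1) * α ^ 2 +
    Complex.normSq (M r 0) * (β ^ 2 + γ ^ 2)) * this

lemma sqNorm_branchComponent_row (θ α β γ : ℝ) (M : Matrix (Fin 2) (Fin 2) ℂ) (r : Fin 2) :
    sqNorm ((coeffMatrix (branchComponent (linkState θ) (wState α β γ) M r))ᵀ *ᵥ ket (0, 0))
      = Real.cos θ ^ 2 * (Complex.normSq (M r 1) * α ^ 2 + Complex.normSq (M r 0) * β ^ 2) := by
  simp [sqNorm, ket, coeffMatrix, branchComponent, distributedState, Fintype.sum_prod_type,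
    wState_apply, linkState_apply, Complex.normSq_ofReal, -Complex.ofReal_cos,
    -Complex.ofReal_sin]
  ring

/-- Restoration in the Bank-measures model requires `cos² θ (α² + β²) ≤ 1 / 2`. -/
theorem BankMeasuresFeasible.cos_sq_mul_le {θ α β γ : ℝ} (hn : α ^ 2 + β ^ 2 + γ ^ 2 = 1)
    (h : BankMeasuresFeasible (linkState θ) (wState α β γ)) :
    Real.cos θ ^ 2 * (α ^ 2 + β ^ 2) ≤ 1 / 2 := by
  obtain ⟨n, M, hM, hfeas⟩ := h
  have hle : ∀ i r, Real.cos θ ^ 2 *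
      (Complex.normSq (M i r 1) * α ^ 2 + Complex.normSq (M i r 0) * β ^ 2) ≤
      (Complex.normSq (M i r 1) * α ^ 2 + Complex.normSq (M i r 0) * (β ^ 2 + γ ^ 2)) / 2 := by
    intro i r
    rw [← sqNorm_branchComponent θ, ← sqNorm_branchComponent_row θ α β γ]
    -- Outcomes of probability zero carry no feasibility hypothesis, but then both sides vanish.
    by_cases h0 : (branch (linkState θ) (wState α β γ) (M i)).trace = 0
    · rw [branch_eq_sum, Matrix.trace_sum] at h0
      simp only [trace_proj] at h0
      have h0' : ∑ r, sqNorm (branchComponent (linkState θ) (wState α β γ) (M i) r) = 0 := by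
        exact_mod_cast h0
      have hr := sqNorm_eq_zero ((Finset.sum_eq_zero_iff_of_nonneg
        fun r _ => sqNorm_nonneg _).1 h0' r (Finset.mem_univ r))
      rw [hr]
      simp [sqNorm, coeffMatrix, Matrix.mulVec, dotProduct]
    · have hi := hfeas i h0
      rw [branch_eq_sum] at hi h0
      simpa [sqNorm_ket] using hi.sqNorm_transpose_coeffMatrix_mulVec_le h0 r (ket (0, 0))
  -- Completeness tested on basis vectors of `K`.
  have hcol : ∀ k, ∑ i, ∑ r, Complex.normSq (M i r k) = 1 := by
    intro k
    have := hM.sum_sqNorm (ket k)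
    rw [sqNorm_ket] at this
    simpa only [sqNorm, ket, Matrix.mulVec_single_one, Matrix.col_apply] using this
  have hsum := Finset.sum_le_sum fun i (_ : i ∈ Finset.univ) =>
    Finset.sum_le_sum fun r (_ : r ∈ Finset.univ) => hle i r
  simp only [← Finset.mul_sum, ← Finset.sum_div, Finset.sum_add_distrib, ← Finset.sum_mul,
    hcol] at hsum
  linarith

end BankAssist

theorem mainTheorem4 :
    ∃ θ α β γ : ℝ, 0 < θ ∧ θ ≤ Real.pi / 4 ∧ 0 < α ∧ 0 < β ∧ 0 < γ ∧
      α ^ 2 + β ^ 2 + γ ^ 2 = 1 ∧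
      BankAssist.TransferFeasible (BankAssist.linkState θ) (BankAssist.wState α β γ) ∧
      ¬ BankAssist.BankMeasuresFeasible (BankAssist.linkState θ) (BankAssist.wState α β γ) := by
  have hα : Real.sqrt (1 / 2) ^ 2 = 1 / 2 := Real.sq_sqrt (by norm_num)
  have hβ : Real.sqrt (1 / 3) ^ 2 = 1 / 3 := Real.sq_sqrt (by norm_num)
  have hγ : Real.sqrt (1 / 6) ^ 2 = 1 / 6 := Real.sq_sqrt (by norm_num)
  have hn : Real.sqrt (1 / 2) ^ 2 + Real.sqrt (1 / 3) ^ 2 + Real.sqrt (1 / 6) ^ 2 = 1 := by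
    rw [hα, hβ, hγ]; norm_num
  have hcos : Real.cos (Real.pi / 6) ^ 2 = 3 / 4 := by
    rw [Real.cos_pi_div_six, div_pow, Real.sq_sqrt (by norm_num)]; norm_num
  -- Here `cos² θ = 3/4`, so the two quantities are `3/4 · 2/3 = 1/2` and `3/4 · 5/6 = 5/8`.
  refine ⟨Real.pi / 6, Real.sqrt (1 / 2), Real.sqrt (1 / 3), Real.sqrt (1 / 6), by positivity, ?_,
    by positivity, by positivity, by positivity, hn, ?_, fun h => ?_⟩
  · linarith [Real.pi_pos]
  · refine BankAssist.transferFeasible hn ?_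
    rw [hcos, hα, hγ]; norm_num
  · have := h.cos_sq_mul_le hn
    rw [hcos, hα, hβ] at this
    norm_num at this
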